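/- For a family $\Lambda_n=(\lambda_1,\dots,\lambda_n)$ of complex numbers (repetitions allowed) let $S_m(\Lambda_n)=\sum_{k=1}^n\lambda_k^m$ be its power sums. (1) Let $n\ge 2$ and $a\ge 0$. If $|S_m(\Lambda_n)|\le a^m$ for $m=1,\dots,n$, then $$\max_{k=1,\dots,n}|\lambda_k|\le(1+\varepsilon_n)\,a,\qquad \varepsilon_n:=\frac{2(\ln n-\ln\ln n)}{n},$$ and also $$\max_{k=1,\dots,n}|\lambda_k|\le\Big(1+\frac{2\ln n}{n}\Big)a.$$ Moreover, $\varepsilon_n<\dfrac{2\ln n}{n}$ for every $n\ge 3$. (2) There is an absolute constant $n_0$ such that for every $n\ge n_0$ there is a number $c_n\in[1/10,1]$ with the following property: for every $a\ge 0$ there is a family $\tilde\Lambda_n=(\tilde\lambda_1,\dots,\tilde\lambda_n)$ of complex numbers with $$|S_m(\tilde\Lambda_n)|\le a^m\quad(m=1,\dots,n)\qquad\text{and}\qquad |\tilde\lambda_1|=\Big(1+\frac{c_n}{n}\Big)a.$$ -/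

import Mathlib

/-- The power sum `S_m(Λ) = ∑ₖ λₖ ^ m` of a finite family (with repetitions) of complex numbers. -/
def powerSum {n : ℕ} (Λ : Fin n → ℂ) (m : ℕ) : ℂ :=
  ∑ k : Fin n, Λ k ^ m

/-- The quantity `ε_n = 2 (ln n - ln ln n) / n`. -/
noncomputable def epsilonN (n : ℕ) : ℝ :=
  2 * (Real.log (n : ℝ) - Real.log (Real.log (n : ℝ))) / (n : ℝ)

/-!
Write `P = ∏ₖ (1 - λₖ X)` and `S = ∑_{i < n} S_{i+1} X ^ i`. Newton's identities say that
`P' + S P` is divisible by `X ^ n`. Everything below rests on this congruence.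

*Upper bound.* By homogeneity take `a = 1`. The congruence bounds the coefficients of `P` by `1`
and those of `P' + S P` by `n`, hence `‖(P' + S P)(z)‖ ≤ n t ^ n / (1 - t)` for `‖z‖ = t < 1`. If
`A` is the antiderivative of `S` with `A(0) = 0`, then `‖exp A(z)‖ ≤ exp (∑ t ^ m / m) ≤ 1 / (1 - t)`,
so the derivative `(P' + S P) exp A` of `P exp A` is at most `n t ^ n / (1 - t) ^ 2` in norm. This
function has the value `1` at `0` and vanishes at `1 / λ`; if `‖λ‖ = 1 + δ > 1`, comparing its growth
along the segment in between with the barrier `t ^ (n + 1) / ((1 - t) (1 - t + t / n))` gives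
`δ (δ + 1 / n) (1 + δ) ^ (n - 1) ≤ 1` (`mul_pow_le_one_of_norm_eq`). The left side increases with `δ`
and is at least `1` at `δ = ε_n` (`one_le_epsilonN_mul_pow`), hence `δ ≤ ε_n`. The second bound is
weaker than the first for `n ≥ 3` and is checked separately for `n = 2`.

*Lower bound.* Conversely, the congruence recovers the first `n` power sums from any polynomial of
degree at most `n` with constant coefficient `1`. The family is a perturbation of
`S_1 = ⋯ = S_n = 1`, for which `P = 1 - X`: put `S_m = 1 - η` for `n / 3 < m < 2 n / 3`, with
`1 - η` on the unit circle, and leave the other `S_m`, `m < n`, equal to `1`. Then, up to degree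
`n`, `P` is `(1 - X) exp (∑ η X ^ m / m)` plus a multiple of `X ^ n`, and the exponential may be cut
after its quadratic term. The multiple of `X ^ n` is chosen to make `1 / x` a zero, where
`x = 1 + 1 / (10 n)`. This fixes `S_n`, and the real part of `η ^ 2` being negative is what keeps
`S_n` in the unit disc (`norm_last_le_one`).
-/

/-! ### Upper bound: Newton's congruence and the growth of `P * exp A` -/

section PowerSums

open Polynomial Finset

/-- The reversed characteristic polynomial `∏ₖ (1 - λₖ X)` of a family `Λ`. -/
noncomputable def reversedCharpoly {n : ℕ} (Λ : Fin n → ℂ) : ℂ[X] :=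
  ∏ k, (1 - C (Λ k) * X)

/-- The polynomial `∑_{i < n} S_{i+1}(Λ) X ^ i`: up to sign, the logarithmic derivative of
`reversedCharpoly Λ` truncated at degree `n`. -/
noncomputable def powerSumPoly {n : ℕ} (Λ : Fin n → ℂ) : ℂ[X] :=
  ∑ i ∈ range n, C (powerSum Λ (i + 1)) * X ^ i

lemma powerSumPoly_coeff {n : ℕ} (Λ : Fin n → ℂ) (i : ℕ) :
    (powerSumPoly Λ).coeff i = if i < n then powerSum Λ (i + 1) else 0 := by
  simp [powerSumPoly, coeff_C_mul, coeff_X_pow]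

/-- Newton's identities in the form of a single polynomial congruence. -/
lemma X_pow_dvd_derivative_reversedCharpoly_add {n : ℕ} (Λ : Fin n → ℂ) :
    X ^ n ∣ derivative (reversedCharpoly Λ) + powerSumPoly Λ * reversedCharpoly Λ := by
  refine ⟨-(∑ k, C (Λ k ^ (n + 1)) * ∏ j ∈ univ.erase k, (1 - C (Λ j) * X)), ?_⟩
  have hA : powerSumPoly Λ = ∑ k, C (Λ k) * ∑ i ∈ range n, (C (Λ k) * X) ^ i := by
    simp only [powerSumPoly, powerSum, map_sum, sum_mul, mul_sum]
    rw [sum_comm]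
    refine sum_congr rfl fun k _ => sum_congr rfl fun i _ => ?_
    rw [pow_succ, C_mul, C_pow]; ring
  have hk : ∀ k : Fin n, reversedCharpoly Λ
      = (1 - C (Λ k) * X) * ∏ j ∈ univ.erase k, (1 - C (Λ j) * X) := fun k =>
    (mul_prod_erase univ (fun j => 1 - C (Λ j) * X) (mem_univ k)).symm
  have hd : derivative (reversedCharpoly Λ)
      = ∑ k, (∏ j ∈ univ.erase k, (1 - C (Λ j) * X)) * (-C (Λ k)) := by
    rw [reversedCharpoly, derivative_prod_finset]
    refine sum_congr rfl fun k _ => ?_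
    simp
  rw [hA, hd, sum_mul, ← sum_add_distrib, mul_neg, mul_sum, ← sum_neg_distrib]
  refine sum_congr rfl fun k _ => ?_
  rw [hk k]
  have hg := mul_neg_geom_sum (C (Λ k) * X) n
  rw [C_pow]
  linear_combination (C (Λ k) * ∏ j ∈ univ.erase k, (1 - C (Λ j) * X)) * hg

lemma reversedCharpoly_coeff_zero {n : ℕ} (Λ : Fin n → ℂ) :
    (reversedCharpoly Λ).coeff 0 = 1 := by
  simp [reversedCharpoly, coeff_zero_eq_eval_zero, eval_prod]

lemma natDegree_reversedCharpoly_le {n : ℕ} (Λ : Fin n → ℂ) :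
    (reversedCharpoly Λ).natDegree ≤ n := by
  refine (natDegree_prod_le _ _).trans ?_
  refine (sum_le_card_nsmul _ _ 1 fun k _ => ?_).trans (by simp)
  compute_degree

/-- If the first `n` power sums lie in the unit disc, so do all coefficients of the reversed
characteristic polynomial, which the power series of `1 / (1 - X)` majorizes. -/
lemma norm_reversedCharpoly_coeff_le_one {n : ℕ} (Λ : Fin n → ℂ)
    (h : ∀ m, 1 ≤ m → m ≤ n → ‖powerSum Λ m‖ ≤ 1) (j : ℕ) :
    ‖(reversedCharpoly Λ).coeff j‖ ≤ 1 := by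
  induction j using Nat.strong_induction_on with
  | _ j ih =>
    rcases j with _ | j
    · simp [reversedCharpoly_coeff_zero]
    by_cases hj : n < j + 1
    · rw [coeff_eq_zero_of_natDegree_lt ((natDegree_reversedCharpoly_le Λ).trans_lt hj)]
      simp
    have h0 := X_pow_dvd_iff.1 (X_pow_dvd_derivative_reversedCharpoly_add Λ) j (by omega)
    rw [coeff_add, coeff_derivative, coeff_mul] at h0
    have h1 : ‖(reversedCharpoly Λ).coeff (j + 1) * ((j : ℂ) + 1)‖ ≤ (j : ℝ) + 1 := by
      rw [eq_neg_of_add_eq_zero_left h0, norm_neg]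
      refine (norm_sum_le_of_le (f := fun x : ℕ × ℕ =>
        (powerSumPoly Λ).coeff x.1 * (reversedCharpoly Λ).coeff x.2)
        (n := fun _ => (1 : ℝ)) _ fun x hx => ?_).trans (by simp)
      have hx' := mem_antidiagonal.1 hx
      rw [norm_mul, powerSumPoly_coeff, if_pos (by omega)]
      exact mul_le_one₀ (h _ (by omega) (by omega)) (norm_nonneg _) (ih _ (by omega))
    have hj0 : (0 : ℝ) < (j : ℝ) + 1 := by positivity
    have h2 : ‖(j : ℂ) + 1‖ = (j : ℝ) + 1 := by
      rw [show (j : ℂ) + 1 = ((j + 1 : ℕ) : ℂ) by push_cast; ring, Complex.norm_natCast]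
      push_cast; ring
    rw [norm_mul, h2] at h1
    nlinarith

/-- The remainder in Newton's congruence is small at points `z` of the open unit disc. -/
lemma norm_eval_derivative_reversedCharpoly_add_le {n : ℕ} (Λ : Fin n → ℂ)
    (h : ∀ m, 1 ≤ m → m ≤ n → ‖powerSum Λ m‖ ≤ 1) {z : ℂ} (hz : ‖z‖ < 1) :
    ‖(derivative (reversedCharpoly Λ) + powerSumPoly Λ * reversedCharpoly Λ).eval z‖
      ≤ n * ‖z‖ ^ n / (1 - ‖z‖) := by
  obtain ⟨T, hT⟩ := X_pow_dvd_derivative_reversedCharpoly_add Λ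
  have hc : ∀ k, ‖T.coeff k‖ ≤ n := by
    intro k
    have h1 : T.coeff k = (X ^ n * T).coeff (k + n) := (coeff_X_pow_mul T n k).symm
    rw [h1, ← hT, coeff_add, coeff_derivative, coeff_eq_zero_of_natDegree_lt
      ((natDegree_reversedCharpoly_le Λ).trans_lt (by omega)), zero_mul, zero_add,
      powerSumPoly, sum_mul, finsetSum_coeff]
    refine (norm_sum_le_of_le (n := fun _ => (1 : ℝ)) _ fun i hi => ?_).trans (by simp)
    have hi' := mem_range.1 hi
    rw [mul_assoc, coeff_C_mul, coeff_X_pow_mul', norm_mul]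
    refine mul_le_one₀ (h _ (by omega) (by omega)) (norm_nonneg _) ?_
    split_ifs
    · exact norm_reversedCharpoly_coeff_le_one Λ h _
    · simp
  have hz1 : 0 < 1 - ‖z‖ := by linarith
  have hTz : ‖T.eval z‖ ≤ n / (1 - ‖z‖) := by
    rw [eval_eq_sum_range]
    have h2 : ∑ i ∈ range (T.natDegree + 1), ‖z‖ ^ i ≤ (1 - ‖z‖)⁻¹ :=
      sum_le_hasSum _ (fun i _ => by positivity)
        (hasSum_geometric_of_lt_one (norm_nonneg z) hz)
    calc _ ≤ ∑ i ∈ range (T.natDegree + 1), (n : ℝ) * ‖z‖ ^ i :=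
          norm_sum_le_of_le _ fun i _ => by
            rw [norm_mul, norm_pow]
            exact mul_le_mul_of_nonneg_right (hc i) (by positivity)
      _ ≤ n / (1 - ‖z‖) := by
          rw [← mul_sum, div_eq_mul_inv]
          exact mul_le_mul_of_nonneg_left h2 (by positivity)
  rw [hT, eval_mul, eval_pow, eval_X, norm_mul, norm_pow]
  calc ‖z‖ ^ n * ‖T.eval z‖ ≤ ‖z‖ ^ n * (n / (1 - ‖z‖)) :=
        mul_le_mul_of_nonneg_left hTz (by positivity)
    _ = _ := by ring

/-- An antiderivative of `powerSumPoly Λ` is bounded by `-log (1 - ‖z‖)`, which after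
exponentiation gives a bound by `1 / (1 - ‖z‖)`. -/
lemma norm_exp_sum_powerSum_le {n : ℕ} (Λ : Fin n → ℂ)
    (h : ∀ m, 1 ≤ m → m ≤ n → ‖powerSum Λ m‖ ≤ 1) {z : ℂ} (hz : ‖z‖ < 1) :
    ‖Complex.exp ((∑ i ∈ range n, C (powerSum Λ (i + 1) / ((i : ℂ) + 1)) * X ^ (i + 1)).eval z)‖
      ≤ 1 / (1 - ‖z‖) := by
  have hz1 : 0 < 1 - ‖z‖ := by linarith
  rw [Complex.norm_exp]
  have h1 : ‖(∑ i ∈ range n, C (powerSum Λ (i + 1) / ((i : ℂ) + 1)) * X ^ (i + 1)).eval z‖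
      ≤ -Real.log (1 - ‖z‖) := by
    rw [eval_finsetSum]
    refine (norm_sum_le_of_le (n := fun i : ℕ => ‖z‖ ^ (i + 1) / ((i : ℝ) + 1)) _
      fun i hi => ?_).trans (sum_le_hasSum _ (fun i _ => by positivity)
        (Real.hasSum_pow_div_log_of_abs_lt_one (by simpa using hz)))
    have hi' := mem_range.1 hi
    have h2 : ‖(i : ℂ) + 1‖ = (i : ℝ) + 1 := by
      rw [show (i : ℂ) + 1 = ((i + 1 : ℕ) : ℂ) by push_cast; ring, Complex.norm_natCast]
      push_cast; ring
    rw [eval_mul, eval_C, eval_pow, eval_X, norm_mul, norm_div, norm_pow, h2, div_mul_eq_mul_div]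
    have := h (i + 1) (by omega) (by omega)
    gcongr
    exact mul_le_of_le_one_left (by positivity) this
  have h3 := (Complex.re_le_norm _).trans h1
  calc _ ≤ Real.exp (-Real.log (1 - ‖z‖)) := Real.exp_le_exp.2 h3
    _ = 1 / (1 - ‖z‖) := by rw [Real.exp_neg, Real.exp_log hz1, one_div]

/-- The function `t ^ (n + 1) / ((1 - t) (1 - t + t / n))` is a barrier for the growth rate
`n t ^ n / (1 - t) ^ 2`. -/
lemma exists_hasDerivAt_barrier {n : ℕ} (hn : 1 ≤ n) {t : ℝ} (ht0 : 0 ≤ t) (ht1 : t < 1) :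
    ∃ b : ℝ, HasDerivAt (fun t : ℝ => t ^ (n + 1) / ((1 - t) * (1 - t + t / n))) b t ∧
      n * t ^ n / (1 - t) ^ 2 ≤ b := by
  have hn0 : (0 : ℝ) < n := by exact_mod_cast hn
  have hs : 0 < 1 - t := by linarith
  have hD : 0 < 1 - t + t / n := by positivity
  have h1 : HasDerivAt (fun t : ℝ => 1 - t) (-1) t := by
    simpa using (hasDerivAt_id t).const_sub 1
  have h2 : HasDerivAt (fun t : ℝ => 1 - t + t / n) (-1 + 1 / n) t :=
    h1.add ((hasDerivAt_id t).div_const _)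
  have h3 := (hasDerivAt_pow (n + 1) t).fun_div (h1.fun_mul h2) (by positivity)
  refine ⟨_, h3, ?_⟩
  rw [div_le_div_iff₀ (by positivity) (by positivity)]
  have hn1 : (1 : ℝ) / n ≤ 1 := by rw [div_le_one hn0]; exact_mod_cast hn
  have hkey : 0 ≤ (1 - t) * (1 - t + t / n) + (1 - 1 / n) * t * (1 - t) := by
    have : 0 ≤ (1 - 1 / (n : ℝ)) * t := mul_nonneg (by linarith) ht0
    nlinarith [mul_pos hs hD]
  have hfac : 0 ≤ t ^ n * (1 - t) ^ 2 *
      ((1 - t) * (1 - t + t / n) + (1 - 1 / n) * t * (1 - t)) := by positivity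
  have hid : ((((n + 1 : ℕ) : ℝ) * t ^ (n + 1 - 1)) * ((1 - t) * (1 - t + t / n)) -
      t ^ (n + 1) * ((-1) * (1 - t + t / n) + (1 - t) * (-1 + 1 / n))) * (1 - t) ^ 2
      - n * t ^ n * ((1 - t) * (1 - t + t / n)) ^ 2
      = t ^ n * (1 - t) ^ 2 * ((1 - t) * (1 - t + t / n) + (1 - 1 / n) * t * (1 - t)) := by
    simp only [Nat.add_sub_cancel, pow_succ]
    push_cast
    field_simp
    ring
  linarith

/-- A member of modulus `1 + δ > 1` of a family with power sums in the unit disc is the inverse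
of a zero of the reversed characteristic polynomial `P` at distance `r = 1 / (1 + δ)` from the
origin. With `A` the antiderivative of `powerSumPoly Λ`, the function `P * exp A` falls from `1`
to `0` on the way there, while its derivative is at most `n t ^ n / (1 - t) ^ 2`. -/
theorem mul_pow_le_one_of_norm_eq {n : ℕ} (Λ : Fin n → ℂ)
    (h : ∀ m, 1 ≤ m → m ≤ n → ‖powerSum Λ m‖ ≤ 1) (k : Fin n) {δ : ℝ} (hδ : 0 < δ)
    (hk : ‖Λ k‖ = 1 + δ) :
    δ * (δ + 1 / n) * (1 + δ) ^ (n - 1) ≤ 1 := by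
  have hn : 1 ≤ n := by have := k.2; omega
  have hn0 : (0 : ℝ) < n := by exact_mod_cast hn
  set A : ℂ[X] := ∑ i ∈ range n, C (powerSum Λ (i + 1) / ((i : ℂ) + 1)) * X ^ (i + 1) with hA
  have hA' : derivative A = powerSumPoly Λ := by
    rw [hA, derivative_sum, powerSumPoly]
    refine sum_congr rfl fun i _ => ?_
    rw [derivative_C_mul_X_pow]
    have : (i : ℂ) + 1 ≠ 0 := by exact_mod_cast Nat.succ_ne_zero i
    simp only [Nat.add_sub_cancel]
    congr 2
    push_cast
    field_simp
  set P := reversedCharpoly Λ with hP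
  have hδ1 : 0 < 1 + δ := by linarith
  have hΛ : Λ k ≠ 0 := by
    intro h0; rw [h0, norm_zero] at hk; linarith
  set r : ℝ := 1 / (1 + δ) with hr
  have hr0 : 0 < r := by positivity
  have hr1 : r < 1 := by rw [hr, div_lt_one hδ1]; linarith
  set ω : ℂ := (‖Λ k‖ : ℂ) * (Λ k)⁻¹ with hω
  have hω1 : ‖ω‖ = 1 := by
    rw [hω, norm_mul, norm_inv, Complex.norm_real, norm_norm,
      mul_inv_cancel₀ (norm_ne_zero_iff.2 hΛ)]
  have hrω : (r : ℂ) * ω = (Λ k)⁻¹ := by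
    rw [hω, hk, hr]
    have : (1 : ℂ) + δ ≠ 0 := by exact_mod_cast hδ1.ne'
    push_cast
    field_simp
  have hroot : P.eval ((r : ℂ) * ω) = 0 := by
    rw [hrω, hP, reversedCharpoly, eval_prod]
    exact prod_eq_zero (mem_univ k) (by simp [hΛ])
  have hder : ∀ t : ℝ, HasDerivAt
      (fun t : ℝ => P.eval ((t : ℂ) * ω) * Complex.exp (A.eval ((t : ℂ) * ω)) - 1)
      (ω * ((derivative P + powerSumPoly Λ * P).eval ((t : ℂ) * ω))
        * Complex.exp (A.eval ((t : ℂ) * ω))) t := by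
    intro t
    have hl : HasDerivAt (fun z : ℂ => z * ω) ω (t : ℂ) := by
      simpa using (hasDerivAt_id (t : ℂ)).mul_const ω
    have hp := (P.hasDerivAt ((t : ℂ) * ω)).comp (t : ℂ) hl
    have ha := ((A.hasDerivAt ((t : ℂ) * ω)).comp (t : ℂ) hl).cexp
    have := ((hp.mul ha).sub_const 1).comp_ofReal
    refine this.congr_deriv ?_
    simp only [Function.comp, hA', eval_add, eval_mul]
    ring
  choose! b hb hb' using fun (t : ℝ) (ht : 0 ≤ t ∧ t < 1) =>
    exists_hasDerivAt_barrier hn ht.1 ht.2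
  have hmain := image_norm_le_of_norm_deriv_right_le_deriv_boundary'
    (f := fun t : ℝ => P.eval ((t : ℂ) * ω) * Complex.exp (A.eval ((t : ℂ) * ω)) - 1)
    (a := 0) (b := r)
    (B := fun t : ℝ => t ^ (n + 1) / ((1 - t) * (1 - t + t / n))) (B' := b)
    (fun t _ => (hder t).continuousAt.continuousWithinAt)
    (fun t _ => (hder t).hasDerivWithinAt)
    (by
      have h0 : P.eval 0 = 1 := by
        rw [← coeff_zero_eq_eval_zero]; exact reversedCharpoly_coeff_zero Λ
      have h1 : A.eval 0 = 0 := by simp [hA, eval_finsetSum]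
      simp [h0, h1])
    (fun t ht => (hb t ⟨ht.1, ht.2.trans_lt hr1⟩).continuousAt.continuousWithinAt)
    (fun t ht => (hb t ⟨ht.1, ht.2.trans hr1⟩).hasDerivWithinAt)
    (fun t ht => by
      have ht1 : t < 1 := ht.2.trans hr1
      have hnt : ‖(t : ℂ) * ω‖ = t := by
        rw [norm_mul, hω1, mul_one, Complex.norm_real, Real.norm_of_nonneg ht.1]
      have hlt : ‖(t : ℂ) * ω‖ < 1 := by rw [hnt]; exact ht1
      have h1 := norm_eval_derivative_reversedCharpoly_add_le Λ h hlt
      have h2 := norm_exp_sum_powerSum_le Λ h hlt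
      rw [hnt] at h1 h2
      rw [norm_mul, norm_mul, hω1, one_mul]
      have hs : 0 < 1 - t := by linarith
      refine (mul_le_mul h1 h2 (norm_nonneg _)
        (div_nonneg (mul_nonneg hn0.le (pow_nonneg ht.1 _)) hs.le)).trans ?_
      refine le_trans (le_of_eq ?_) (hb' t ⟨ht.1, ht1⟩)
      field_simp)
    (x := r) ⟨hr0.le, le_rfl⟩
  simp only [hroot, zero_mul, zero_sub, norm_neg, norm_one] at hmain
  have e1 : 1 - r = δ * r := by rw [hr]; field_simp; ring
  have e2 : 1 - r + r / n = r * (δ + 1 / n) := by rw [e1]; ring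
  obtain ⟨j, rfl⟩ : ∃ j, n = j + 1 := ⟨n - 1, by omega⟩
  rw [e2, e1, one_le_div (by positivity)] at hmain
  have hrx : r * (1 + δ) = 1 := by rw [hr]; field_simp
  have e3 : δ * (δ + 1 / (j + 1 : ℕ)) ≤ r ^ j := by
    have : (δ * (δ + 1 / (j + 1 : ℕ))) * r ^ 2 ≤ r ^ j * r ^ 2 := by
      calc _ = δ * r * (r * (δ + 1 / (j + 1 : ℕ))) := by ring
        _ ≤ _ := hmain
        _ = _ := by ring
    exact le_of_mul_le_mul_right this (by positivity)
  rw [Nat.add_sub_cancel]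
  calc _ ≤ r ^ j * (1 + δ) ^ j := mul_le_mul_of_nonneg_right e3 (by positivity)
    _ = 1 := by rw [← mul_pow, hrx, one_pow]

end PowerSums

/-! ### The value of the bound at `ε_n` -/

section RealEstimates

/-- With `q = u / L ≤ 1.5825`, this is the inequality to which the estimate of `ε_n` reduces
after taking logarithms; `E` stands for `exp L = n / u`. -/
lemma add_div_le_of_cubic_le {L q E : ℝ} (hL : 1 ≤ L) (hq : 1 ≤ q) (hq' : q ≤ 1.5825)
    (hE : 1 + L + L ^ 2 / 2 + L ^ 3 / 6 ≤ E) :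
    2 * (L + 1) / (q * E + 1) ≤ 0.46 + 2 * (1 - q / 1.5825) + 2 / (4 * L + 1) := by
  have hL0 : 0 < L := by linarith
  have hEL : L + 1 ≤ E := by nlinarith [pow_pos hL0 2, pow_pos hL0 3]
  have hE0 : 0 < E := by linarith
  have hqE : E ≤ q * E := by nlinarith
  have h1 : (L + 1) / (q * E + 1) ≤ (L + 1) / (1.5825 * E + 1) + (1 - q / 1.5825) := by
    have hid : (L + 1) / (q * E + 1) - (L + 1) / (1.5825 * E + 1)
        = (L + 1) * E * (1.5825 - q) / ((q * E + 1) * (1.5825 * E + 1)) := by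
      field_simp; ring
    have : (L + 1) * E * (1.5825 - q) / ((q * E + 1) * (1.5825 * E + 1)) ≤ 1 - q / 1.5825 := by
      rw [div_le_iff₀ (by positivity)]
      have h2 : (L + 1) * E * 1.5825 ≤ (q * E + 1) * (1.5825 * E + 1) := by nlinarith
      have h3 : 0 ≤ (1.5825 - q) / 1.5825 := div_nonneg (by linarith) (by norm_num)
      calc (L + 1) * E * (1.5825 - q) = (1.5825 - q) / 1.5825 * ((L + 1) * E * 1.5825) := by
            field_simp
        _ ≤ (1.5825 - q) / 1.5825 * ((q * E + 1) * (1.5825 * E + 1)) :=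
            mul_le_mul_of_nonneg_left h2 h3
        _ = _ := by ring
    linarith
  have h4 : 2 * ((L + 1) / (1.5825 * E + 1)) ≤ 0.46 + 2 / (4 * L + 1) := by
    rw [← mul_div_assoc, div_le_iff₀ (by positivity)]
    have h5 : (0.46 : ℝ) + 2 / (4 * L + 1) = (2.46 + 1.84 * L) / (4 * L + 1) := by
      field_simp; ring
    rw [h5, div_mul_eq_mul_div, le_div_iff₀ (by positivity)]
    have h6 : (2.46 + 1.84 * L) * (1.58 * (1 + L + L ^ 2 / 2 + L ^ 3 / 6) + 1)
        ≤ (2.46 + 1.84 * L) * (1.5825 * E + 1) :=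
      mul_le_mul_of_nonneg_left (by linarith) (by positivity)
    refine le_trans ?_ h6
    nlinarith [mul_nonneg hL0.le (sq_nonneg (L - 1.2)), sq_nonneg (L - 1), sq_nonneg (L ^ 2),
      sq_nonneg (L - 1.2)]
  have h7 : 2 * (L + 1) / (q * E + 1) = 2 * ((L + 1) / (q * E + 1)) := by ring
  linarith

lemma one_le_log_of_three_le {n : ℕ} (hn : 3 ≤ n) : 1 < Real.log n := by
  rw [Real.lt_log_iff_exp_lt (by positivity)]
  have h3 : (3 : ℝ) ≤ n := by exact_mod_cast hn
  linarith [Real.exp_one_lt_d9]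

lemma two_div_le_epsilonN {n : ℕ} (hn : 2 ≤ n) : 2 / (n : ℝ) ≤ epsilonN n := by
  have hu : 0 < Real.log n := Real.log_pos (by exact_mod_cast hn)
  have := Real.log_le_sub_one_of_pos hu
  unfold epsilonN
  gcongr
  linarith

/-- The value `ε_n` violates (weakly) the inequality satisfied by the excess `δ`. -/
theorem one_le_epsilonN_mul_pow {n : ℕ} (hn : 2 ≤ n) :
    1 ≤ epsilonN n * (epsilonN n + 1 / n) * (1 + epsilonN n) ^ (n - 1) := by
  rcases hn.eq_or_lt with rfl | hn3
  · have := two_div_le_epsilonN (le_refl 2)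
    norm_num at this ⊢
    nlinarith [mul_nonneg (sub_nonneg.2 this) (sub_nonneg.2 this)]
  have hn0 : (0 : ℝ) < n := by positivity
  set u := Real.log n with hu
  have hu1 : 1 < u := one_le_log_of_three_le hn3
  have hu0 : 0 < u := by linarith
  set L := u - Real.log u with hL
  have hLu : L ≤ u := by have := Real.log_pos hu1; linarith
  have hL1 : 1 ≤ L := by have := Real.log_le_sub_one_of_pos hu0; linarith
  have hL0 : 0 < L := by linarith
  have hε : epsilonN n = 2 * L / n := rfl
  -- `log u ≤ u / e` bounds `q = u / L` by `e / (e - 1)`.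
  have hq : u / L ≤ 1.5825 := by
    rw [div_le_iff₀ hL0]
    have h1 : Real.log u ≤ u * Real.exp (-1) := by
      have := Real.log_le_sub_one_of_pos (x := u * Real.exp (-1)) (by positivity)
      rw [Real.log_mul hu0.ne' (Real.exp_pos _).ne', Real.log_exp] at this
      linarith
    have h2 : Real.exp (-1) ≤ 0.36788 := by
      rw [Real.exp_neg, inv_le_comm₀ (Real.exp_pos _) (by norm_num)]
      exact le_trans (by norm_num) Real.exp_one_gt_d9.le
    nlinarith
  have hq1 : 1 ≤ u / L := by rwa [one_le_div hL0]
  have hE : Real.exp L = n / u := by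
    rw [hL, Real.exp_sub, hu, Real.exp_log hn0, ← hu, Real.exp_log hu0]
  have hcub : 1 + L + L ^ 2 / 2 + L ^ 3 / 6 ≤ n / u := by
    rw [← hE]
    have := Real.sum_le_exp_of_nonneg hL0.le 4
    simpa [Finset.sum_range_succ, Nat.factorial] using this
  have hkey := add_div_le_of_cubic_le hL1 hq1 hq hcub
  have hqE : u / L * (n / u) = n / L := by field_simp
  rw [hqE] at hkey
  have hε0 : 0 < epsilonN n := by rw [hε]; positivity
  rw [← Real.log_nonneg_iff (by positivity)]
  rw [Real.log_mul (by positivity) (by positivity), Real.log_mul (by positivity) (by positivity),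
    Real.log_pow]
  have l1 : Real.log (epsilonN n) = Real.log 2 + Real.log L - u := by
    rw [hε, Real.log_div (by positivity) (by positivity),
      Real.log_mul (by positivity) (by positivity)]
  have l2 : Real.log (epsilonN n + 1 / n)
      = Real.log 2 + Real.log L + Real.log (1 + 1 / (2 * L)) - u := by
    rw [← Real.log_mul (by positivity) (by positivity),
      ← Real.log_mul (by positivity) (by positivity),
      ← Real.log_div (by positivity) (by positivity), hε]
    congr 1
    field_simp
  have l3 : 2 / (4 * L + 1) ≤ Real.log (1 + 1 / (2 * L)) := by
    refine le_trans (le_of_eq ?_) (Real.le_log_one_add_of_nonneg (x := 1 / (2 * L)) (by positivity))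
    field_simp
    ring
  have l4 : 2 * L - 2 * (L + 1) / (n / L + 1)
      ≤ ((n - 1 : ℕ) : ℝ) * Real.log (1 + epsilonN n) := by
    rw [Nat.cast_sub (by omega), Nat.cast_one]
    have h1 : (0 : ℝ) ≤ (n : ℝ) - 1 := by
      have : (1 : ℝ) ≤ n := by exact_mod_cast (by omega : 1 ≤ n)
      linarith
    refine le_trans (le_of_eq ?_)
      (mul_le_mul_of_nonneg_left (Real.le_log_one_add_of_nonneg hε0.le) h1)
    rw [hε]
    field_simp
    ring
  -- `log 2 - log q` is bounded below by the tangent line of `log` at `q = 1.5825`.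
  have l5 : 0.23 + (1 - u / L / 1.5825) ≤ Real.log 2 + Real.log L - Real.log u := by
    have h1 : Real.log (u / L / 1.5825) ≤ u / L / 1.5825 - 1 :=
      Real.log_le_sub_one_of_pos (by positivity)
    have h2 : (0.23 : ℝ) ≤ Real.log (2 / 1.5825) := by
      rw [show (2 : ℝ) / 1.5825 = 1 + (2 / 1.5825 - 1) by ring]
      exact le_trans (by norm_num) (Real.le_log_one_add_of_nonneg (by norm_num))
    rw [Real.log_div (by positivity) (by norm_num), Real.log_div (by positivity) (by positivity)]
      at h1
    rw [Real.log_div (by norm_num) (by norm_num)] at h2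
    linarith
  rw [l1, l2]
  linarith

theorem one_le_log_two_mul_pow :
    1 ≤ (2 * Real.log (2 : ℕ) / (2 : ℕ)) * (2 * Real.log (2 : ℕ) / (2 : ℕ) + 1 / (2 : ℕ))
      * (1 + 2 * Real.log (2 : ℕ) / (2 : ℕ)) ^ (2 - 1) := by
  have := Real.log_two_gt_d9
  have h : 2 * Real.log (2 : ℕ) / (2 : ℕ) = Real.log 2 := by push_cast; ring
  rw [h]
  norm_num
  have h1 : (0.69 : ℝ) ≤ Real.log 2 := by linarith
  nlinarith [mul_nonneg (sub_nonneg.2 h1) (sub_nonneg.2 h1),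
    mul_nonneg (mul_nonneg (sub_nonneg.2 h1) (sub_nonneg.2 h1)) (sub_nonneg.2 h1)]

theorem epsilonN_lt {n : ℕ} (hn : 3 ≤ n) : epsilonN n < 2 * Real.log n / n := by
  have h := Real.log_pos (one_le_log_of_three_le hn)
  have hn0 : (0 : ℝ) < n := by positivity
  unfold epsilonN
  gcongr
  linarith

end RealEstimates

/-! ### Lower bound: a family with prescribed power sums -/

section Construction

open Polynomial Finset

lemma exists_eq_mul_of_eval_eq_zero {n : ℕ} {P : ℂ[X]} {z : ℂ} (hP : P.natDegree ≤ n + 1)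
    (h0 : P.coeff 0 = 1) (hz : P.eval z = 0) :
    ∃ Q : ℂ[X], Q.natDegree ≤ n ∧ Q.coeff 0 = 1 ∧ P = (1 - C z⁻¹ * X) * Q := by
  obtain ⟨Q, rfl⟩ := dvd_iff_isRoot.2 hz
  have hz0 : z ≠ 0 := by
    rintro rfl
    simp at h0
  have hQ0 : Q ≠ 0 := by
    rintro rfl
    simp at h0
  refine ⟨C (-z) * Q, ?_, ?_, ?_⟩
  · rw [natDegree_C_mul (neg_ne_zero.2 hz0)]
    rw [natDegree_mul (X_sub_C_ne_zero z) hQ0, natDegree_X_sub_C] at hP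
    omega
  · rw [mul_coeff_zero] at h0 ⊢
    simpa using h0
  · have : C z⁻¹ * C z = (1 : ℂ[X]) := by rw [← C_mul, inv_mul_cancel₀ hz0, C_1]
    rw [C_neg]
    linear_combination (-X * Q) * this

lemma reversedCharpoly_cons {n : ℕ} (l : ℂ) (Λ : Fin n → ℂ) :
    reversedCharpoly (Fin.cons l Λ : Fin (n + 1) → ℂ) = (1 - C l * X) * reversedCharpoly Λ := by
  simp [reversedCharpoly, Fin.prod_univ_succ]

/-- Every polynomial of degree at most `n` with constant coefficient `1` is a reversed
characteristic polynomial; vanishing entries of the family make up for a smaller degree. -/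
lemma exists_reversedCharpoly_eq (n : ℕ) (P : ℂ[X]) (hP : P.natDegree ≤ n) (h0 : P.coeff 0 = 1) :
    ∃ Λ : Fin n → ℂ, reversedCharpoly Λ = P := by
  induction n generalizing P with
  | zero =>
    refine ⟨0, ?_⟩
    rw [eq_C_of_natDegree_le_zero hP, h0]
    simp [reversedCharpoly]
  | succ n ih =>
    by_cases hd : P.natDegree = 0
    · refine ⟨0, ?_⟩
      rw [eq_C_of_natDegree_eq_zero hd, h0]
      simp [reversedCharpoly]
    · obtain ⟨z, hz⟩ := IsAlgClosed.exists_root P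
        (fun h => hd (natDegree_eq_of_degree_eq_some h))
      obtain ⟨Q, hQ, hQ0, rfl⟩ := exists_eq_mul_of_eval_eq_zero hP h0 hz
      obtain ⟨Λ, rfl⟩ := ih Q hQ hQ0
      exact ⟨Fin.cons z⁻¹ Λ, reversedCharpoly_cons _ _⟩

/-- Newton's congruence determines the power sums. -/
lemma powerSum_eq_coeff {n : ℕ} (Λ : Fin n → ℂ) (T : ℂ[X])
    (h : X ^ n ∣ derivative (reversedCharpoly Λ) + T * reversedCharpoly Λ) {i : ℕ} (hi : i < n) :
    powerSum Λ (i + 1) = T.coeff i := by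
  have h1 := dvd_sub (X_pow_dvd_derivative_reversedCharpoly_add Λ) h
  rw [show derivative (reversedCharpoly Λ) + powerSumPoly Λ * reversedCharpoly Λ -
    (derivative (reversedCharpoly Λ) + T * reversedCharpoly Λ)
    = reversedCharpoly Λ * (powerSumPoly Λ - T) by ring] at h1
  have h2 : X ^ n ∣ powerSumPoly Λ - T := by
    refine prime_X.pow_dvd_of_dvd_mul_left n (fun h => ?_) h1
    rw [X_dvd_iff, reversedCharpoly_coeff_zero] at h
    exact one_ne_zero h
  have h3 := X_pow_dvd_iff.1 h2 i hi
  rw [coeff_sub, powerSumPoly_coeff, if_pos hi] at h3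
  exact sub_eq_zero.1 h3

/-- The integers strictly between `n / 3` and `2 n / 3`. A sum of three of them exceeds `n`, so
that only terms up to the second order matter. -/
def middleThird (n : ℕ) : Finset ℕ := Icc (n / 3 + 1) ((2 * n - 1) / 3)

lemma mem_middleThird {n m : ℕ} : m ∈ middleThird n ↔ n < 3 * m ∧ 3 * m < 2 * n := by
  rw [middleThird, mem_Icc]
  omega

/-- The sum of `1 / m` over the middle third, which is close to `log 2`. -/
noncomputable def middleSum (n : ℕ) : ℝ := ∑ m ∈ middleThird n, 1 / (m : ℝ)

lemma sum_middleThird_eq (n : ℕ) :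
    ∑ m ∈ middleThird n, (n : ℝ) / (m * (n - m : ℕ)) = 2 * middleSum n := by
  have hrefl : ∑ m ∈ middleThird n, 1 / ((n - m : ℕ) : ℝ) = middleSum n := by
    refine sum_nbij' (fun m => n - m) (fun m => n - m) ?_ ?_ ?_ ?_ ?_ <;>
      simp only [mem_middleThird] <;> intros <;> first | omega | trivial
  rw [two_mul]
  nth_rewrite 1 [← hrefl]
  rw [middleSum, ← sum_add_distrib]
  refine sum_congr rfl fun m hm => ?_
  have := mem_middleThird.1 hm
  have h1 : (0 : ℝ) < m := by exact_mod_cast (by omega : 0 < m)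
  have h2 : (0 : ℝ) < (n : ℝ) - m := sub_pos.2 (by exact_mod_cast (by omega : m < n))
  rw [Nat.cast_sub (by omega)]
  field_simp
  ring

lemma middleSum_bounds {n : ℕ} (hn : 1000 ≤ n) : 0.66 ≤ middleSum n ∧ middleSum n ≤ 0.76 := by
  have hn0 : (1000 : ℝ) ≤ n := by exact_mod_cast hn
  have hcard : n ≤ 3 * #(middleThird n) + 3 ∧ 3 * #(middleThird n) ≤ n + 1 := by
    rw [middleThird, Nat.card_Icc]
    omega
  have hc1 : (n : ℝ) ≤ 3 * #(middleThird n) + 3 := by exact_mod_cast hcard.1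
  have hc2 : 3 * (#(middleThird n) : ℝ) ≤ n + 1 := by exact_mod_cast hcard.2
  have hpos : (0 : ℝ) < n := by linarith
  have hterm : ∀ m ∈ middleThird n, 4 / (n : ℝ) ≤ (n : ℝ) / (m * (n - m : ℕ)) ∧
      (n : ℝ) / (m * (n - m : ℕ)) ≤ 9 / (2 * n) := by
    intro m hm
    have hm' := mem_middleThird.1 hm
    have h1 : (n : ℝ) < 3 * m := by exact_mod_cast hm'.1
    have h2 : 3 * (m : ℝ) < 2 * n := by exact_mod_cast hm'.2
    rw [Nat.cast_sub (by omega)]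
    have h3 : (0 : ℝ) < m := by linarith
    have h4 : (0 : ℝ) < n - m := by linarith
    constructor
    · rw [div_le_div_iff₀ hpos (by positivity)]
      nlinarith [sq_nonneg ((n : ℝ) - 2 * m)]
    · rw [div_le_div_iff₀ (by positivity) (by positivity)]
      nlinarith
  have hlo := card_nsmul_le_sum _ _ _ fun m hm => (hterm m hm).1
  have hhi := sum_le_card_nsmul _ _ _ fun m hm => (hterm m hm).2
  rw [sum_middleThird_eq, nsmul_eq_mul] at hlo hhi
  constructor
  · rw [mul_div_assoc', div_le_iff₀ hpos] at hlo
    nlinarith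
  · rw [mul_div_assoc', le_div_iff₀ (by positivity)] at hhi
    nlinarith

lemma sum_sum_middleThird_eq {n : ℕ} (hn : 1 ≤ n) :
    ∑ m ∈ middleThird n, ∑ m' ∈ middleThird n, (if m + m' = n then 1 / ((m : ℝ) * m') else 0)
      = 2 * middleSum n / n := by
  have hn0 : (0 : ℝ) < n := by exact_mod_cast hn
  rw [← sum_middleThird_eq, sum_div]
  refine sum_congr rfl fun m hm => ?_
  have hm' := mem_middleThird.1 hm
  rw [sum_eq_single_of_mem (n - m) (by rw [mem_middleThird]; omega)
    (fun b _ hb => if_neg (by omega)), if_pos (by omega)]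
  field_simp

/-- The polynomial `∑ (η / m) X ^ m` over the middle third. -/
noncomputable def middlePoly (n : ℕ) (η : ℂ) : ℂ[X] := ∑ m ∈ middleThird n, C (η / m) * X ^ m

lemma middlePoly_coeff (n : ℕ) (η : ℂ) (i : ℕ) :
    (middlePoly n η).coeff i = if i ∈ middleThird n then η / i else 0 := by
  simp [middlePoly, coeff_C_mul, coeff_X_pow]

lemma X_pow_dvd_middlePoly (n : ℕ) (η : ℂ) : X ^ (n / 3 + 1) ∣ middlePoly n η := by
  refine X_pow_dvd_iff.2 fun d hd => ?_
  rw [middlePoly_coeff, if_neg]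
  rw [mem_middleThird]
  omega

/-- The expansion of `exp (middlePoly n η)` up to degree `n`, with the coefficient of `X ^ n` in
closed form and the part of lower degree estimated. -/
lemma exists_expansion {n : ℕ} (hn : 1 ≤ n) (η : ℂ) : ∃ W U : ℂ[X],
    1 + middlePoly n η + C (1 / 2) * middlePoly n η ^ 2
      = W + C (η ^ 2 * middleSum n / n) * X ^ n + X ^ (n + 1) * U ∧
    W.natDegree < n ∧ W.coeff 0 = 1 ∧
    ∀ z : ℂ, ‖z‖ ≤ 1 → ‖W.eval z - 1‖ ≤ ‖η‖ * middleSum n + (‖η‖ * middleSum n) ^ 2 / 2 := by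
  refine ⟨1 + (middlePoly n η + ∑ m ∈ middleThird n, ∑ m' ∈ middleThird n,
      if m + m' < n then C (1 / 2 * (η / m * (η / m'))) * X ^ (m + m') else 0),
    ∑ m ∈ middleThird n, ∑ m' ∈ middleThird n,
      if n < m + m' then C (1 / 2 * (η / m * (η / m'))) * X ^ (m + m' - (n + 1)) else 0,
    ?_, ?_, ?_, ?_⟩
  · have hdiag : C (η ^ 2 * middleSum n / n) * X ^ n
        = ∑ m ∈ middleThird n, ∑ m' ∈ middleThird n,
          if m + m' = n then C (1 / 2 * (η / m * (η / m'))) * X ^ (m + m') else (0 : ℂ[X]) := by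
      have h1 := congrArg (fun x : ℝ => (x : ℂ)) (sum_sum_middleThird_eq hn)
      simp only [Complex.ofReal_sum, apply_ite Complex.ofReal, Complex.ofReal_zero] at h1
      push_cast at h1
      have h2 : η ^ 2 * middleSum n / n = ∑ m ∈ middleThird n, ∑ m' ∈ middleThird n,
          η ^ 2 / 2 * (if m + m' = n then 1 / ((m : ℂ) * m') else 0) := by
        simp only [← mul_sum]
        rw [h1]
        ring
      rw [h2, map_sum, sum_mul]
      refine sum_congr rfl fun m _ => ?_
      rw [map_sum, sum_mul]
      refine sum_congr rfl fun m' _ => ?_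
      split_ifs with h
      · rw [h]
        congr 2
        ring
      · simp
    have hsq : C (1 / 2) * middlePoly n η ^ 2 = ∑ m ∈ middleThird n, ∑ m' ∈ middleThird n,
        C (1 / 2 * (η / m * (η / m'))) * X ^ (m + m') := by
      rw [sq, middlePoly, sum_mul_sum, mul_sum]
      refine sum_congr rfl fun m _ => ?_
      rw [mul_sum]
      refine sum_congr rfl fun m' _ => ?_
      rw [C_mul, C_mul, pow_add]
      ring
    rw [hsq, hdiag, add_assoc, add_assoc, add_assoc, add_assoc]
    congr 2
    simp only [mul_sum, ← sum_add_distrib]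
    refine sum_congr rfl fun m _ => sum_congr rfl fun m' _ => ?_
    rcases lt_trichotomy (m + m') n with h | h | h
    · simp [h, h.ne, h.not_gt]
    · simp [h]
    · rw [if_neg h.not_gt, if_neg h.ne', if_pos h, zero_add, zero_add, mul_left_comm (X ^ (n + 1)),
        ← pow_add]
      congr 2
      omega
  · refine lt_of_le_of_lt (b := n - 1) ?_ (by omega)
    refine natDegree_add_le_of_degree_le (by simp) (natDegree_add_le_of_degree_le ?_ ?_)
    · refine natDegree_sum_le_of_forall_le _ _ fun m hm => ?_
      have := mem_middleThird.1 hm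
      exact (natDegree_C_mul_X_pow_le _ _).trans (by omega)
    · refine natDegree_sum_le_of_forall_le _ _ fun m _ =>
        natDegree_sum_le_of_forall_le _ _ fun m' _ => ?_
      split_ifs
      · exact (natDegree_C_mul_X_pow_le _ _).trans (by omega)
      · simp
  · rw [coeff_add, coeff_add, coeff_one_zero, middlePoly_coeff,
      if_neg (by rw [mem_middleThird]; omega), finsetSum_coeff, sum_eq_zero, add_zero, add_zero]
    intro m hm
    rw [finsetSum_coeff]
    refine sum_eq_zero fun m' _ => ?_
    have := mem_middleThird.1 hm
    split_ifs
    · rw [coeff_C_mul, coeff_X_pow, if_neg (by omega), mul_zero]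
    · simp
  · intro z hz
    have hterm : ∀ m : ℕ, ‖η / m‖ = ‖η‖ * (1 / m) := fun m => by
      rw [norm_div, Complex.norm_natCast]; ring
    have h1 : ‖(middlePoly n η).eval z‖ ≤ ‖η‖ * middleSum n := by
      rw [middlePoly, eval_finsetSum, middleSum, mul_sum]
      refine norm_sum_le_of_le _ fun m _ => ?_
      rw [eval_mul, eval_C, eval_pow, eval_X, norm_mul, norm_pow, hterm]
      exact mul_le_of_le_one_right (by positivity) (pow_le_one₀ (norm_nonneg _) hz)
    have h2 : ‖(∑ m ∈ middleThird n, ∑ m' ∈ middleThird n,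
        if m + m' < n then C (1 / 2 * (η / m * (η / m'))) * X ^ (m + m') else (0 : ℂ[X])).eval z‖
        ≤ (‖η‖ * middleSum n) ^ 2 / 2 := by
      have h3 : (‖η‖ * middleSum n) ^ 2 / 2 = ∑ m ∈ middleThird n, ∑ m' ∈ middleThird n,
          1 / 2 * ((‖η‖ * (1 / m)) * (‖η‖ * (1 / m'))) := by
        simp only [← mul_sum]
        rw [← sum_mul, ← mul_sum, middleSum]
        ring
      rw [h3, eval_finsetSum]
      refine norm_sum_le_of_le _ fun m _ => ?_
      rw [eval_finsetSum]
      refine norm_sum_le_of_le _ fun m' _ => ?_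
      split_ifs
      · rw [eval_mul, eval_C, eval_pow, eval_X, norm_mul, norm_pow, norm_mul, norm_mul, hterm,
          hterm, norm_div, norm_one, Complex.norm_ofNat]
        exact mul_le_of_le_one_right (by positivity) (pow_le_one₀ (norm_nonneg _) hz)
      · rw [eval_zero, norm_zero]
        positivity
    rw [eval_add, eval_add, eval_one, add_sub_cancel_left]
    exact (norm_add_le _ _).trans (add_le_add h1 h2)

/-- The power sums of the family whose reversed characteristic polynomial is
`(1 - X) * W + g * X ^ n`, where `W` is the part of degree less than `n` of the exponential of
`middlePoly n η`: the coefficient `g` affects the last of them only. -/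
lemma powerSum_of_reversedCharpoly_eq {n : ℕ} (hn : 1 ≤ n) (η g : ℂ) {W U : ℂ[X]}
    (hW : 1 + middlePoly n η + C (1 / 2) * middlePoly n η ^ 2
      = W + C (η ^ 2 * middleSum n / n) * X ^ n + X ^ (n + 1) * U)
    {Λ : Fin n → ℂ} (hΛ : reversedCharpoly Λ = (1 - X) * W + C g * X ^ n) {m : ℕ} (hm : 1 ≤ m)
    (hmn : m ≤ n) :
    powerSum Λ m = if m = n then 1 - (n * g - η ^ 2 * middleSum n)
      else if m ∈ middleThird n then 1 - η else 1 := by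
  have hn0 : (n : ℂ) ≠ 0 := by exact_mod_cast (by omega : n ≠ 0)
  set e : ℂ := n * g - η ^ 2 * middleSum n with he
  set B : ℂ[X] := middlePoly n η + C (e / n) * X ^ n with hB
  have hhalf : 2 * C (1 / 2 : ℂ) = 1 := by
    rw [show (2 : ℂ[X]) = C 2 from rfl, ← C_mul]
    norm_num
  have hX0 : X ^ (n / 3 + 1) ∣ B :=
    dvd_add (X_pow_dvd_middlePoly n η) (dvd_mul_of_dvd_right (pow_dvd_pow X (by omega)) _)
  have hX1 : X ^ n ∣ derivative B * B ^ 2 := by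
    have h1 := pow_sub_one_dvd_derivative_of_pow_dvd hX0
    have h2 := mul_dvd_mul h1 (pow_dvd_pow_of_dvd hX0 2)
    rw [← pow_mul, ← pow_add] at h2
    exact (pow_dvd_pow X (by omega)).trans h2
  have hX2 : X ∣ middlePoly n η := (dvd_pow_self X (by omega)).trans (X_pow_dvd_middlePoly n η)
  obtain ⟨V, hV⟩ : ∃ V, (1 - X) * W + C g * X ^ n
      = (1 - X) * (1 + B + C (1 / 2) * B ^ 2) + X ^ (n + 1) * V := by
    obtain ⟨b, hb⟩ := hX2
    obtain ⟨j, rfl⟩ : ∃ j, n = j + 1 := ⟨n - 1, by omega⟩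
    have hg : C g = C (η ^ 2 * middleSum (j + 1) / (j + 1 : ℕ)) + C (e / (j + 1 : ℕ)) := by
      rw [← C_add, he]
      congr 1
      field_simp
      ring
    refine ⟨C g - (1 - X) * (U + C (e / (j + 1 : ℕ)) * b +
      C (1 / 2) * C (e / (j + 1 : ℕ)) ^ 2 * X ^ j), ?_⟩
    rw [hB]
    have hb' : C (e / (j + 1 : ℕ)) * X ^ (j + 1) * middlePoly (j + 1) η
      = X ^ (j + 1 + 1) * (C (e / (j + 1 : ℕ)) * b) := by rw [hb]; ring
    linear_combination (-(1 - X)) * hW + (X ^ (j + 1) - X ^ (j + 2)) * hg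
      - (1 - X) * hb' - (1 - X) * (C (e / (j + 1 : ℕ)) * X ^ (j + 1) * middlePoly (j + 1) η) * hhalf
  have hdvd : X ^ n ∣ derivative (reversedCharpoly Λ)
      + (∑ i ∈ range n, X ^ i - derivative B) * reversedCharpoly Λ := by
    obtain ⟨Y, hY⟩ := hX1
    have hgeom := mul_neg_geom_sum (X : ℂ[X]) n
    rw [hΛ, hV]
    have hD : derivative ((1 - X) * (1 + B + C (1 / 2) * B ^ 2) + X ^ (n + 1) * V)
        = -(1 + B + C (1 / 2) * B ^ 2) + (1 - X) * (derivative B + C (1 / 2) * (2 * B * derivative B))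
          + X ^ n * (C ((n + 1 : ℕ) : ℂ) * V + X * derivative V) := by
      rw [sq B]
      simp only [derivative_add, derivative_mul, derivative_sub, derivative_one, derivative_X,
        derivative_C, derivative_X_pow, Nat.add_sub_cancel]
      ring
    rw [hD]
    refine ⟨-(1 + B + C (1 / 2) * B ^ 2) - C (1 / 2) * (1 - X) * Y + C ((n + 1 : ℕ) : ℂ) * V
      + X * derivative V + X * V * (∑ i ∈ range n, X ^ i - derivative B), ?_⟩
    linear_combination (1 + B + C (1 / 2) * B ^ 2) * hgeom + (1 - X) * derivative B * B * hhalf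
      - C (1 / 2) * (1 - X) * hY
  obtain ⟨i, rfl⟩ : ∃ i, m = i + 1 := ⟨m - 1, by omega⟩
  rw [powerSum_eq_coeff Λ _ hdvd (by omega), coeff_sub, coeff_derivative, hB, coeff_add,
    middlePoly_coeff, coeff_C_mul, coeff_X_pow, finsetSum_coeff]
  have hi0 : (i : ℂ) + 1 ≠ 0 := by exact_mod_cast Nat.succ_ne_zero i
  have hone : ∑ b ∈ range n, (X ^ b : ℂ[X]).coeff i = 1 := by
    simp only [coeff_X_pow]
    rw [sum_ite_eq]
    exact if_pos (mem_range.2 (by omega))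
  rw [hone]
  by_cases h1 : i + 1 = n
  · rw [if_pos h1, if_pos h1, if_neg (by rw [mem_middleThird]; omega)]
    rw [← h1] at hn0 ⊢
    push_cast at hn0 ⊢
    field_simp
    ring
  · rw [if_neg h1, if_neg h1]
    split_ifs
    · push_cast
      field_simp
      ring
    · ring

/-- With `η = (1 + 3 i) / 5`, which makes `1 - η` unimodular and `η ^ 2` have negative real part,
the last power sum of the constructed family stays in the unit disc. -/
lemma norm_last_le_one {κ H : ℝ} (hκ0 : 0 ≤ κ) (hκ : κ ≤ 1 / 9) (hH : 0.66 ≤ H) (hH' : H ≤ 0.76)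
    {w : ℂ} (hw : ‖w - 1‖ ≤ ‖(⟨1 / 5, 3 / 5⟩ : ℂ)‖ * H + (‖(⟨1 / 5, 3 / 5⟩ : ℂ)‖ * H) ^ 2 / 2) :
    ‖1 - (-(κ : ℂ) * w - (⟨1 / 5, 3 / 5⟩ : ℂ) ^ 2 * H)‖ ≤ 1 := by
  have hη : ‖(⟨1 / 5, 3 / 5⟩ : ℂ)‖ ≤ 0.6325 := by
    rw [← sq_le_sq₀ (norm_nonneg _) (by norm_num), Complex.sq_norm, Complex.normSq_apply]
    norm_num
  have h1 : ‖w - 1‖ ≤ 0.6 := by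
    have : ‖(⟨1 / 5, 3 / 5⟩ : ℂ)‖ * H ≤ 0.6325 * 0.76 := by gcongr
    have h0 : 0 ≤ ‖(⟨1 / 5, 3 / 5⟩ : ℂ)‖ * H := by positivity
    nlinarith
  have h2 : ‖(1 : ℂ) + κ + (⟨1 / 5, 3 / 5⟩ : ℂ) ^ 2 * H‖ ≤ 0.93 := by
    rw [← sq_le_sq₀ (norm_nonneg _) (by norm_num), Complex.sq_norm, Complex.normSq_apply]
    simp only [sq, Complex.add_re, Complex.add_im, Complex.mul_re, Complex.mul_im,
      Complex.ofReal_re, Complex.ofReal_im, Complex.one_re, Complex.one_im]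
    have a1 : 1 + κ - 0.32 * H ≤ 1 + 1 / 9 - 0.32 * H := by linarith
    have a2 : (1 + κ - 0.32 * H) ^ 2 ≤ (1 + 1 / 9 - 0.32 * H) ^ 2 := by
      gcongr
      linarith
    nlinarith [mul_nonneg (sub_nonneg.2 hH) (sub_nonneg.2 hH')]
  have h3 : ‖(κ : ℂ) * (w - 1)‖ ≤ 1 / 9 * 0.6 := by
    rw [norm_mul, Complex.norm_real, Real.norm_of_nonneg hκ0]
    gcongr
  calc _ = ‖((1 : ℂ) + κ + (⟨1 / 5, 3 / 5⟩ : ℂ) ^ 2 * H) + (κ : ℂ) * (w - 1)‖ := by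
        congr 1; ring
    _ ≤ _ := norm_add_le _ _
    _ ≤ 1 := by linarith

theorem exists_family_normalized {n : ℕ} (hn : 1000 ≤ n) (hn0 : 0 < n) : ∃ Λ : Fin n → ℂ,
    (∀ m, 1 ≤ m → m ≤ n → ‖powerSum Λ m‖ ≤ 1) ∧ Λ ⟨0, hn0⟩ = ((1 + 1 / 10 / n : ℝ) : ℂ) := by
  have hnr : (1000 : ℝ) ≤ n := by exact_mod_cast hn
  have hpos : (0 : ℝ) < n := by linarith
  obtain ⟨W, U, hWU, hWdeg, hW0, hWb⟩ := exists_expansion (by omega : 1 ≤ n) ⟨1 / 5, 3 / 5⟩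
  set x : ℝ := 1 + 1 / 10 / n with hx
  have hx1 : 1 ≤ x := by rw [hx]; linarith [show (0 : ℝ) ≤ 1 / 10 / n by positivity]
  have hx0 : 0 < x := by linarith
  have hxc : (x : ℂ) ≠ 0 := by exact_mod_cast hx0.ne'
  -- The coefficient of `X ^ n` that makes `1 / x` a zero.
  set g : ℂ := -(1 - (x : ℂ)⁻¹) * (x : ℂ) ^ n * W.eval (x : ℂ)⁻¹ with hg
  set P : ℂ[X] := (1 - X) * W + C g * X ^ n with hP
  have hPdeg : P.natDegree ≤ n := by
    refine natDegree_add_le_of_degree_le ?_ (natDegree_C_mul_X_pow_le _ _)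
    refine natDegree_mul_le.trans ?_
    have : (1 - X : ℂ[X]).natDegree ≤ 1 := by compute_degree
    omega
  have hP0 : P.coeff 0 = 1 := by
    rw [hP, coeff_add, mul_coeff_zero, hW0, coeff_C_mul, coeff_X_pow, if_neg (by omega)]
    simp
  have hPz : P.eval (x : ℂ)⁻¹ = 0 := by
    rw [hP]
    simp only [eval_add, eval_mul, eval_sub, eval_one, eval_X, eval_C, eval_pow]
    rw [hg, inv_pow]
    field_simp
    ring
  obtain ⟨Λ, hΛ, hΛ0⟩ : ∃ Λ : Fin n → ℂ, reversedCharpoly Λ = P ∧ Λ ⟨0, hn0⟩ = (x : ℂ) := by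
    obtain ⟨j, rfl⟩ : ∃ j, n = j + 1 := ⟨n - 1, by omega⟩
    obtain ⟨Q, hQ, hQ0, hPQ⟩ := exists_eq_mul_of_eval_eq_zero hPdeg hP0 hPz
    obtain ⟨Λ, hΛ⟩ := exists_reversedCharpoly_eq j Q hQ hQ0
    refine ⟨Fin.cons (x : ℂ) Λ, ?_, rfl⟩
    rw [reversedCharpoly_cons, hΛ, hPQ, inv_inv]
  refine ⟨Λ, fun m hm hmn => ?_, hΛ0⟩
  rw [powerSum_of_reversedCharpoly_eq (by omega) _ g hWU (hΛ.trans hP) hm hmn]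
  split_ifs
  · obtain ⟨hH, hH'⟩ := middleSum_bounds hn
    have hxn : x ^ n ≤ 10 / 9 := by
      have h1 : x ≤ Real.exp (1 / 10 / n) := by
        rw [hx, add_comm]
        exact Real.add_one_le_exp _
      calc x ^ n ≤ Real.exp (1 / 10 / n) ^ n := by gcongr
        _ = Real.exp (1 / 10) := by
          rw [← Real.exp_nat_mul]
          congr 1
          field_simp
        _ ≤ 10 / 9 := by
          have := Real.exp_bound_div_one_sub_of_interval (x := 1 / 10) (by norm_num) (by norm_num)
          exact this.trans (by norm_num)
    have hnx : n * (1 - x⁻¹) = 1 / 10 * x⁻¹ := by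
      have : (n : ℝ) * x = n + 1 / 10 := by rw [hx]; field_simp
      field_simp
      linarith
    have hxi : x⁻¹ ≤ 1 := inv_le_one_of_one_le₀ hx1
    have hκ0 : 0 ≤ n * (1 - x⁻¹) * x ^ n := by rw [hnx]; positivity
    have hκ : n * (1 - x⁻¹) * x ^ n ≤ 1 / 9 := by
      rw [hnx]
      calc 1 / 10 * x⁻¹ * x ^ n ≤ 1 / 10 * 1 * (10 / 9) := by gcongr
        _ = 1 / 9 := by norm_num
    have hz : ‖(x : ℂ)⁻¹‖ ≤ 1 := by
      rwa [norm_inv, Complex.norm_real, Real.norm_of_nonneg hx0.le]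
    refine le_of_eq_of_le ?_ (norm_last_le_one hκ0 hκ hH hH' (hWb _ hz))
    congr 2
    rw [hg]
    push_cast
    ring
  · rw [← sq_le_sq₀ (norm_nonneg _) zero_le_one, Complex.sq_norm, Complex.normSq_apply]
    simp only [Complex.sub_re, Complex.sub_im, Complex.one_re, Complex.one_im]
    norm_num
  · simp

end Construction

/-! ### Scaling and conclusion -/

section Scaling

lemma powerSum_const_mul {n : ℕ} (c : ℂ) (Λ : Fin n → ℂ) (m : ℕ) :
    powerSum (fun k => c * Λ k) m = c ^ m * powerSum Λ m := by
  simp [powerSum, mul_pow, Finset.mul_sum]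

/-- By homogeneity, the bound for power sums in the unit disc extends to all `a ≥ 0`; the case
`a = 0` is a limit of the case `a > 0`. -/
lemma norm_le_mul_of_one_le {n : ℕ} {ε : ℝ} (hε : 0 < ε)
    (h1 : 1 ≤ ε * (ε + 1 / n) * (1 + ε) ^ (n - 1)) {a : ℝ} (ha : 0 ≤ a) (Λ : Fin n → ℂ)
    (h : ∀ m : ℕ, 1 ≤ m → m ≤ n → ‖powerSum Λ m‖ ≤ a ^ m) (k : Fin n) :
    ‖Λ k‖ ≤ (1 + ε) * a := by
  have hpos : ∀ b : ℝ, 0 < b → (∀ m : ℕ, 1 ≤ m → m ≤ n → ‖powerSum Λ m‖ ≤ b ^ m) →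
      ‖Λ k‖ ≤ (1 + ε) * b := by
    intro b hb hS
    have hn0 : (0 : ℝ) < n := by exact_mod_cast k.pos
    have hbn : ‖((b : ℂ)⁻¹)‖ = b⁻¹ := by
      rw [norm_inv, Complex.norm_real, Real.norm_of_nonneg hb.le]
    by_contra! hlt
    have hδ : ε < b⁻¹ * ‖Λ k‖ - 1 := by
      have : 1 + ε < b⁻¹ * ‖Λ k‖ := by
        rw [inv_mul_eq_div, lt_div_iff₀ hb]
        exact hlt
      linarith
    have hle := mul_pow_le_one_of_norm_eq (fun k => (b : ℂ)⁻¹ * Λ k)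
      (fun m hm hmn => by
        rw [powerSum_const_mul, norm_mul, norm_pow, hbn, inv_pow, inv_mul_le_iff₀ (by positivity),
          mul_one]
        exact hS m hm hmn) k (hε.trans hδ) (by simp only [norm_mul, hbn]; ring)
    set δ := b⁻¹ * ‖Λ k‖ - 1
    have : ε * (ε + 1 / n) * (1 + ε) ^ (n - 1) < δ * (δ + 1 / n) * (1 + δ) ^ (n - 1) := by
      have hδ0 : 0 < δ := hε.trans hδ
      have h3 : (1 + ε) ^ (n - 1) ≤ (1 + δ) ^ (n - 1) := by gcongr
      have h4 : ε * (ε + 1 / n) < δ * (δ + 1 / n) := by gcongr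
      exact mul_lt_mul h4 h3 (by positivity) (by positivity)
    linarith
  refine le_of_forall_pos_le_add fun η hη => ?_
  have hb : 0 < a + η / (1 + ε) := by positivity
  refine (hpos _ hb fun m hm hmn => (h m hm hmn).trans ?_).trans (le_of_eq ?_)
  · gcongr
    exact le_add_of_nonneg_right (by positivity)
  · field_simp

end Scaling

theorem theorem1 :
    (∀ n : ℕ, 2 ≤ n → ∀ a : ℝ, 0 ≤ a → ∀ Λ : Fin n → ℂ,
      (∀ m : ℕ, 1 ≤ m → m ≤ n → ‖powerSum Λ m‖ ≤ a ^ m) →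
        ∀ k : Fin n, ‖Λ k‖ ≤ (1 + epsilonN n) * a ∧
          ‖Λ k‖ ≤ (1 + 2 * Real.log (n : ℝ) / (n : ℝ)) * a) ∧
    (∀ n : ℕ, 3 ≤ n → epsilonN n < 2 * Real.log (n : ℝ) / (n : ℝ)) ∧
    (∃ n₀ : ℕ, ∀ n : ℕ, n₀ ≤ n → ∃ c : ℝ, 1 / 10 ≤ c ∧ c ≤ 1 ∧
      ∀ a : ℝ, 0 ≤ a → ∃ Λ : Fin n → ℂ,
        (∀ m : ℕ, 1 ≤ m → m ≤ n → ‖powerSum Λ m‖ ≤ a ^ m) ∧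
          ∃ hn : 0 < n, ‖Λ ⟨0, hn⟩‖ = (1 + c / (n : ℝ)) * a) := by
  refine ⟨fun n hn a ha Λ h k => ?_, fun n hn => epsilonN_lt hn,
    1000, fun n hn => ⟨1 / 10, le_rfl, by norm_num, fun a ha => ?_⟩⟩
  · have hε : 0 < epsilonN n :=
      lt_of_lt_of_le (div_pos two_pos (by positivity)) (two_div_le_epsilonN hn)
    have h1 := norm_le_mul_of_one_le hε (one_le_epsilonN_mul_pow hn) ha Λ h k
    refine ⟨h1, ?_⟩
    -- For `n = 2` the second bound is the stronger one, as `log (log 2) < 0`.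
    rcases hn.eq_or_lt with rfl | hn3
    · exact norm_le_mul_of_one_le (by
        have := Real.log_pos one_lt_two
        push_cast
        positivity)
        one_le_log_two_mul_pow ha Λ h k
    · refine h1.trans ?_
      have := (epsilonN_lt hn3).le
      gcongr
  · have hn0 : 0 < n := by omega
    obtain ⟨Λ, hS, hΛ⟩ := exists_family_normalized hn hn0
    refine ⟨fun k => (a : ℂ) * Λ k, fun m hm hmn => ?_, hn0, ?_⟩
    · rw [powerSum_const_mul, norm_mul, norm_pow, Complex.norm_real, Real.norm_of_nonneg ha]
      exact mul_le_of_le_one_right (by positivity) (hS m hm hmn)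
    · simp only [hΛ, norm_mul, Complex.norm_real, Real.norm_of_nonneg ha]
      rw [Real.norm_of_nonneg (by positivity)]
      ring
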